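/- Let $N\ge 3$ be an integer and $\mu_1,\mu_2>1$ real numbers. For $p\in(0,1)$, carry out independent realizations of a random experiment, in each of which an event $H$ has probability $p$, until $N$ occurrences of $H$ have been obtained; let $\mathbf n$ be the number of realizations carried out, let $$\hat{\mathbf p}=\frac{N-1}{\mathbf n},$$ and let $c=\Pr[p/\mu_2\le\hat{\mathbf p}\le p\mu_1]$. Put $$\bar c=\gamma\bigl(N,(N-1)\mu_2\bigr)-\gamma\Bigl(N,\frac{N-1}{\mu_1}\Bigr),\qquad \gamma(r,x)=\frac1{\Gamma(r)}\int_0^x e^{-t}t^{r-1}\,dt .$$ Then $c\to\bar c$ as $p\to0^+$. Moreover, if $$\mu_2\ge\frac{N+\sqrt N}{N-1}\qquad\text{and}\qquad \mu_1\ge\frac{N-1}{N-\frac12-\sqrt{N-\frac12}},$$ then $c>\bar c$ for every $p\in(0,1)$. -/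

import Mathlib

open MeasureTheory ProbabilityTheory

noncomputable section

/-- The regularized lower incomplete gamma function
`γ(r, x) = (1 / Γ(r)) ∫₀ˣ e^{-t} t^{r-1} dt`. -/
def regLowerGamma (r x : ℝ) : ℝ :=
  1 / Real.Gamma r * ∫ t in (0 : ℝ)..x, Real.exp (-t) * t ^ (r - 1)

/-- `H 0, H 1, H 2, …` are the events that the event of interest occurs in the first, second,
third, … of infinitely many independent realizations, in each of which it has probability `p`. -/
structure IsIndepTrials {Ω : Type*} [MeasurableSpace Ω] (P : Measure Ω) (H : ℕ → Set Ω)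
    (p : ℝ) : Prop where
  isProbabilityMeasure : IsProbabilityMeasure P
  measurableSet : ∀ i, MeasurableSet (H i)
  indep : iIndepSet H P
  prob : ∀ i, P (H i) = ENNReal.ofReal p

open Classical in
/-- The number of occurrences in the first `k` realizations. -/
def occurrences {Ω : Type*} (H : ℕ → Set Ω) (k : ℕ) (ω : Ω) : ℕ :=
  ((Finset.range k).filter (fun i => ω ∈ H i)).card

/-- The number of realizations carried out until `N` occurrences are obtained: the least `k` such
that there are `N` occurrences among the first `k` realizations. (It is given the value `0` on the
outcomes with fewer than `N` occurrences in all, which form a null set if `0 < p`.) -/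
def numTrials {Ω : Type*} (H : ℕ → Set Ω) (N : ℕ) (ω : Ω) : ℕ :=
  sInf {k : ℕ | occurrences H k ω = N}

/-- The estimator `p̂ = (N - 1) / n`. -/
def estimator {Ω : Type*} (H : ℕ → Set Ω) (N : ℕ) (ω : Ω) : ℝ :=
  ((N : ℝ) - 1) / (numTrials H N ω : ℝ)

/-- The confidence `c = Pr[p / μ₂ ≤ p̂ ≤ p μ₁]`. -/
def confidence {Ω : Type*} [MeasurableSpace Ω] (P : Measure Ω) (H : ℕ → Set Ω) (N : ℕ)
    (p μ₁ μ₂ : ℝ) : ℝ :=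
  P.real {ω | p / μ₂ ≤ estimator H N ω ∧ estimator H N ω ≤ p * μ₁}

/-- The asymptotic confidence `c̄ = γ(N, (N-1) μ₂) - γ(N, (N-1) / μ₁)`. -/
def asympConfidence (N : ℕ) (μ₁ μ₂ : ℝ) : ℝ :=
  regLowerGamma N (((N : ℝ) - 1) * μ₂) - regLowerGamma N (((N : ℝ) - 1) / μ₁)

end

/-! The `N`-th occurrence comes by trial `k` exactly when the first `k` trials contain at least `N`
occurrences, so `c` is a difference of binomial probabilities of fewer than `N` occurrences: `m =
⌈y/p⌉ - 1` trials minus `n = ⌊x/p⌋` trials, where `y = (N-1)/μ₁` and `x = (N-1)μ₂`. Since `γ(N, ·)`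
is one minus the Poisson probability of a value below `N`, `c̄` is the same difference for Poisson
laws of means `y` and `x`, and the limit is the Poisson limit theorem.

For the strict inequality, rounding gives `p m < y` and `x < p (n + 1)`. Fewer than `N` occurrences
is at least as likely for the binomial law with `m` trials as for the Poisson law of mean `p m ≤ N -
√N`, and at most as likely with `n` trials as for the Poisson law of mean `p (n + 1) ≥ N + √N`.
Strict monotonicity of `γ(N, ·)` then replaces these means by `y` and `x`. Both comparisons rest on
one inequality, `descFactorial_mul_one_sub_pow_mul_exp_le`: it settles the boundary value of `k`,
and ratios of consecutive probabilities carry it to the others. -/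

/-! ### The falling factorial inequality -/

/-- The logarithm of the falling factorial `M (M - 1) ⋯ (M - N + 1)`, recentred at `y`, is
controlled by a second-order expression in `y - N`. -/
theorem sum_log_sub_log_add_le {M : ℝ} (N : ℕ) (hM : (N : ℝ) ≤ M) {y : ℝ} (hy0 : 0 ≤ y)
    (hyM : y < M) (hyN : y ≤ N + √(N : ℝ)) :
    ∑ i ∈ Finset.range N, (Real.log (M - i) - Real.log (M - y))
      + M * (Real.log (M - y) - Real.log M) + y
      ≤ ((N : ℝ) - (N - y) ^ 2) / (2 * (M - y)) := by
  induction N generalizing y with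
  | zero =>
    have : y = 0 := by
      apply le_antisymm _ hy0
      simpa using hyN
    subst this
    simp
  | succ N ih =>
    push_cast at hM hyN ⊢
    have hNM : (N : ℝ) < M := by linarith
    have low : ∀ z : ℝ, 0 ≤ z → z ≤ N →
        ∑ i ∈ Finset.range (N + 1), (Real.log (M - i) - Real.log (M - z))
        + M * (Real.log (M - z) - Real.log M) + z
        ≤ ((N : ℝ) + 1 - (N + 1 - z) ^ 2) / (2 * (M - z)) := by
      intro z hz0 hzN
      have hzM : 0 < M - z := by linarith
      have h1 := ih hNM.le hz0 (by linarith)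
        (by linarith [Real.sqrt_nonneg (N : ℝ)])
      have h2 : Real.log (M - N) - Real.log (M - z) ≤ (z - N) / (M - z) := by
        rw [← Real.log_div (by linarith) hzM.ne']
        refine (Real.log_le_sub_one_of_pos (div_pos (by linarith) hzM)).trans (le_of_eq ?_)
        field_simp
        ring
      rw [Finset.sum_range_succ]
      -- The bound grows with `N` by exactly what `log t ≤ t - 1` allows for the new term.
      have h3 : ((N : ℝ) + 1 - (N + 1 - z) ^ 2) / (2 * (M - z))
          = ((N : ℝ) - (N - z) ^ 2) / (2 * (M - z)) + (z - N) / (M - z) := by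
        field_simp
        ring
      linarith
    rcases le_total y N with hy | hy
    · exact low y hy0 hy
    -- Beyond `N` the induction hypothesis need not reach `y`, so the inequality is carried from `N`
    -- to `y`: the first-order terms cancel in `D'`, whose sign is that of `N + 1 - (N + 1 - z)²`.
    set D : ℝ → ℝ := fun z => ((N : ℝ) + 1 - (N + 1 - z) ^ 2) / (2 * (M - z)) -
        (∑ i ∈ Finset.range (N + 1), (Real.log (M - i) - Real.log (M - z))
        + M * (Real.log (M - z) - Real.log M) + z) with hD
    have hder : ∀ z < M, HasDerivAt D
        (((N : ℝ) + 1 - (N + 1 - z) ^ 2) / (2 * (M - z)) / (M - z)) z := by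
      intro z hz
      have hz' : M - z ≠ 0 := by linarith
      have hsub : HasDerivAt (fun z : ℝ => M - z) (-1) z := by
        simpa using (hasDerivAt_id z).const_sub M
      have hlog := hsub.log hz'
      have hs : HasDerivAt (fun z : ℝ => ∑ i ∈ Finset.range (N + 1),
          (Real.log (M - i) - Real.log (M - z)))
          (∑ i ∈ Finset.range (N + 1), -(-1 / (M - z))) z := by
        apply HasDerivAt.fun_sum
        intro i _
        exact hlog.const_sub _
      have hq : HasDerivAt (fun z : ℝ => ((N : ℝ) + 1 - (N + 1 - z) ^ 2))
          (2 * (N + 1 - z)) z := by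
        have := ((((hasDerivAt_id z).const_sub ((N : ℝ) + 1)).pow 2).const_sub ((N : ℝ) + 1))
        refine this.congr_deriv ?_
        simp
      have := (hq.div (hsub.const_mul 2) (mul_ne_zero two_ne_zero hz')).sub
        ((hs.add ((hlog.sub_const (Real.log M)).const_mul M)).add (hasDerivAt_id z))
      refine this.congr_deriv ?_
      simp only [Finset.sum_const, Finset.card_range, nsmul_eq_mul]
      push_cast
      field_simp
      ring
    have hmono : MonotoneOn D (Set.Icc (N : ℝ) y) := by
      apply monotoneOn_of_deriv_nonneg (convex_Icc _ _)
      · intro z hz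
        exact (hder z (hz.2.trans_lt hyM)).continuousAt.continuousWithinAt
      · intro z hz
        rw [interior_Icc] at hz
        exact (hder z (hz.2.trans hyM)).differentiableAt.differentiableWithinAt
      · intro z hz
        rw [interior_Icc] at hz
        rw [(hder z (hz.2.trans hyM)).deriv]
        have hzM : 0 < M - z := by linarith [hz.2]
        have h1 : |(N : ℝ) + 1 - z| ≤ √((N : ℝ) + 1) := by
          rw [abs_le]
          constructor
          · linarith [hz.2]
          · have : 1 ≤ √((N : ℝ) + 1) := by
              rw [Real.one_le_sqrt]
              linarith [Nat.cast_nonneg (α := ℝ) N]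
            linarith [hz.1]
        have h2 : ((N : ℝ) + 1 - z) ^ 2 ≤ N + 1 := by
          rw [← sq_abs, ← Real.sq_sqrt (by positivity : (0 : ℝ) ≤ N + 1)]
          gcongr
          rwa [Real.sq_sqrt (by positivity)]
        have : 0 ≤ (N : ℝ) + 1 - (N + 1 - z) ^ 2 := by linarith
        positivity
    have h0 : 0 ≤ D N := by
      have := low N (Nat.cast_nonneg N) le_rfl
      simp only [hD]
      linarith
    have := h0.trans (hmono ⟨le_rfl, hy⟩ ⟨hy, le_rfl⟩ hy)
    simp only [hD] at this
    linarith

/-- The second-order bound is nonpositive for `y ≤ N - √N` and zero at `N + √N`; past that point the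
left side decreases, its derivative being `(N - y) / (M - y)`. -/
theorem sum_log_sub_log_add_nonpos {M : ℝ} (N : ℕ) (hM : (N : ℝ) ≤ M) {y : ℝ} (hy0 : 0 ≤ y)
    (hyM : y < M) (hyN : y ≤ N - √(N : ℝ) ∨ N + √(N : ℝ) ≤ y) :
    ∑ i ∈ Finset.range N, (Real.log (M - i) - Real.log (M - y))
      + M * (Real.log (M - y) - Real.log M) + y ≤ 0 := by
  have hs := Real.sqrt_nonneg (N : ℝ)
  have hsq := Real.sq_sqrt (Nat.cast_nonneg (α := ℝ) N)
  rcases hyN with hyN | hyN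
  · refine (sum_log_sub_log_add_le N hM hy0 hyM (by linarith)).trans ?_
    apply div_nonpos_of_nonpos_of_nonneg
    · nlinarith
    · linarith
  · have hder : ∀ z < M, HasDerivAt (fun z =>
        ∑ i ∈ Finset.range N, (Real.log (M - i) - Real.log (M - z))
        + M * (Real.log (M - z) - Real.log M) + z) ((N - z) / (M - z)) z := by
      intro z hz
      have hz' : M - z ≠ 0 := by linarith
      have hsub : HasDerivAt (fun z : ℝ => M - z) (-1) z := by
        simpa using (hasDerivAt_id z).const_sub M
      have hlog := hsub.log hz'
      have hs : HasDerivAt (fun z : ℝ => ∑ i ∈ Finset.range N,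
          (Real.log (M - i) - Real.log (M - z)))
          (∑ i ∈ Finset.range N, -(-1 / (M - z))) z := by
        apply HasDerivAt.fun_sum
        intro i _
        exact hlog.const_sub _
      refine ((hs.add ((hlog.sub_const (Real.log M)).const_mul M)).add
        (hasDerivAt_id z)).congr_deriv ?_
      simp only [Finset.sum_const, Finset.card_range, nsmul_eq_mul]
      field_simp
      ring
    have hanti : AntitoneOn (fun z =>
        ∑ i ∈ Finset.range N, (Real.log (M - i) - Real.log (M - z))
        + M * (Real.log (M - z) - Real.log M) + z) (Set.Icc (N + √(N : ℝ)) y) := by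
      apply antitoneOn_of_deriv_nonpos (convex_Icc _ _)
      · intro z hz
        exact (hder z (hz.2.trans_lt hyM)).continuousAt.continuousWithinAt
      · intro z hz
        rw [interior_Icc] at hz
        exact (hder z (hz.2.trans hyM)).differentiableAt.differentiableWithinAt
      · intro z hz
        rw [interior_Icc] at hz
        rw [(hder z (hz.2.trans hyM)).deriv]
        exact div_nonpos_of_nonpos_of_nonneg (by linarith [hz.1]) (by linarith [hz.2])
    refine (hanti ⟨le_rfl, hyN⟩ ⟨hyN, le_rfl⟩ hyN).trans ?_
    refine (sum_log_sub_log_add_le N hM (by positivity) (by linarith) le_rfl).trans (le_of_eq ?_)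
    rw [show (N : ℝ) - (N - (N + √(N : ℝ))) ^ 2 = 0 by ring_nf; rw [hsq]; ring, zero_div]

theorem descFactorial_mul_one_sub_pow_mul_exp_le {N M : ℕ} (hM : N ≤ M) {y : ℝ} (hy0 : 0 ≤ y)
    (hyM : y < M) (hyN : y ≤ N - √(N : ℝ) ∨ N + √(N : ℝ) ≤ y) :
    (M.descFactorial N : ℝ) * (1 - y / M) ^ (M - N) * Real.exp y ≤ (M : ℝ) ^ N := by
  have hM0 : (0 : ℝ) < M := hy0.trans_lt hyM
  have hMy : 0 < (M : ℝ) - y := by linarith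
  have hle := sum_log_sub_log_add_nonpos N (Nat.cast_le.mpr hM) hy0 hyM hyN
  have hpos : (0 : ℝ) < M.descFactorial N := by
    exact_mod_cast Nat.descFactorial_pos.mpr hM
  have hlogd : Real.log (M.descFactorial N) = ∑ i ∈ Finset.range N, Real.log ((M : ℝ) - i) := by
    rw [Nat.descFactorial_eq_prod_range, Nat.cast_prod, Real.log_prod]
    · refine Finset.sum_congr rfl fun i hi => ?_
      rw [Nat.cast_sub ((Finset.mem_range.mp hi).le.trans hM)]
    · intro i hi
      have := Finset.mem_range.mp hi
      exact_mod_cast (by omega : M - i ≠ 0)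
  have h1 : 1 - y / M = ((M : ℝ) - y) / M := by field_simp
  have h1pos : 0 < 1 - y / (M : ℝ) := by rw [h1]; positivity
  rw [← Real.log_le_log_iff (by positivity) (by positivity), Real.log_mul (by positivity)
    (by positivity), Real.log_mul (by positivity) (by positivity), Real.log_pow, Real.log_exp,
    Real.log_pow, hlogd, h1, Real.log_div hMy.ne' hM0.ne', Nat.cast_sub hM]
  simp only [Finset.sum_sub_distrib, Finset.sum_const, Finset.card_range, nsmul_eq_mul] at hle
  linarith

/-! ### Comparison of binomial and Poisson probabilities -/

/-- The probability that a binomial variable with parameters `n` and `p` equals `k`. -/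
noncomputable def binomPMF (n : ℕ) (p : ℝ) (k : ℕ) : ℝ :=
  n.choose k * p ^ k * (1 - p) ^ (n - k)

/-- The probability that a Poisson variable with mean `x` equals `k`. -/
noncomputable def poisPMF (x : ℝ) (k : ℕ) : ℝ :=
  Real.exp (-x) * x ^ k / k.factorial

theorem binomPMF_succ_mul {n k : ℕ} (p : ℝ) (hk : k < n) :
    binomPMF n p (k + 1) * ((k + 1) * (1 - p)) = binomPMF n p k * ((n - k) * p) := by
  have h := Nat.choose_succ_right_eq n k
  have h' : (n.choose (k + 1) : ℝ) * (k + 1) = n.choose k * (n - k) := by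
    rw [← Nat.cast_sub hk.le]
    exact_mod_cast h
  have e : n - k = (n - (k + 1)) + 1 := by omega
  unfold binomPMF
  rw [e, pow_succ, pow_succ]
  linear_combination p ^ k * p * (1 - p) ^ (n - (k + 1)) * (1 - p) * h'

theorem poisPMF_succ_mul (x : ℝ) (k : ℕ) :
    poisPMF x (k + 1) * (k + 1) = poisPMF x k * x := by
  unfold poisPMF
  rw [Nat.factorial_succ, pow_succ]
  push_cast
  field_simp

theorem binomPMF_nonneg {p : ℝ} (hp0 : 0 ≤ p) (hp1 : p ≤ 1) (n k : ℕ) : 0 ≤ binomPMF n p k := by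
  have : 0 ≤ 1 - p := by linarith
  unfold binomPMF
  positivity

theorem sum_binomPMF (n : ℕ) (p : ℝ) : ∑ k ∈ Finset.range (n + 1), binomPMF n p k = 1 := by
  have := add_pow p (1 - p) n
  rw [add_sub_cancel, one_pow] at this
  rw [this]
  exact Finset.sum_congr rfl fun k _ => by unfold binomPMF; ring

theorem sum_poisPMF_le_one {x : ℝ} (hx : 0 ≤ x) (n : ℕ) :
    ∑ k ∈ Finset.range n, poisPMF x k ≤ 1 := by
  have h := Real.sum_le_exp_of_nonneg hx n
  have : ∑ k ∈ Finset.range n, poisPMF x k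
      = Real.exp (-x) * ∑ k ∈ Finset.range n, x ^ k / k.factorial := by
    rw [Finset.mul_sum]
    exact Finset.sum_congr rfl fun k _ => by unfold poisPMF; ring
  rw [this]
  calc _ ≤ Real.exp (-x) * Real.exp x := by gcongr
    _ = 1 := by rw [← Real.exp_add]; simp

theorem binomPMF_le_poisPMF_of_descFactorial_le {n k : ℕ} {p x : ℝ}
    (h : n.descFactorial k * p ^ k * (1 - p) ^ (n - k) * Real.exp x ≤ x ^ k) :
    binomPMF n p k ≤ poisPMF x k := by
  rw [Nat.descFactorial_eq_factorial_mul_choose, Nat.cast_mul] at h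
  unfold binomPMF poisPMF
  rw [Real.exp_neg, le_div_iff₀ (by positivity), le_inv_mul_iff₀ (Real.exp_pos x)]
  linarith

/-- The case `k = N` is the falling factorial inequality with `y = p m`. Upwards from there, the
binomial ratio of consecutive terms is at most the Poisson one because `k ≥ p m`. -/
theorem binomPMF_le_poisPMF_of_le {m N : ℕ} {p : ℝ} (hp0 : 0 < p) (hp1 : p < 1) (hNm : N ≤ m)
    (hm : 0 < m) (h : p * m ≤ N - √(N : ℝ)) {k : ℕ} (hNk : N ≤ k) (hkm : k ≤ m) :
    binomPMF m p k ≤ poisPMF (p * m) k := by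
  have hm' : (0 : ℝ) < m := by exact_mod_cast hm
  induction k, hNk using Nat.le_induction with
  | base =>
    have key := descFactorial_mul_one_sub_pow_mul_exp_le hNm (y := p * m) (by positivity)
      (by nlinarith) (Or.inl h)
    rw [mul_div_assoc, div_self hm'.ne', mul_one] at key
    apply binomPMF_le_poisPMF_of_descFactorial_le
    calc _ = p ^ N * (m.descFactorial N * (1 - p) ^ (m - N) * Real.exp (p * m)) := by ring
      _ ≤ p ^ N * (m : ℝ) ^ N := by gcongr
      _ = _ := (mul_pow _ _ _).symm
  | succ k hk ih =>
    have hb := binomPMF_succ_mul p (show k < m by omega)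
    have hpo := poisPMF_succ_mul (p * m) k
    have h1 := ih (by omega)
    have hb0 := binomPMF_nonneg hp0.le hp1.le m k
    have hk' : (N : ℝ) ≤ k := by exact_mod_cast hk
    have hq : 0 < (k + 1 : ℝ) * (1 - p) := mul_pos (by positivity) (by linarith)
    refine le_of_mul_le_mul_right ?_ hq
    rw [hb, ← mul_assoc (poisPMF _ _), hpo]
    calc binomPMF m p k * ((m - k) * p) ≤ binomPMF m p k * (p * m * (1 - p)) := by
          refine mul_le_mul_of_nonneg_left ?_ hb0
          nlinarith [Real.sqrt_nonneg (N : ℝ)]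
      _ ≤ poisPMF (p * m) k * (p * m * (1 - p)) := by
          have : 0 ≤ 1 - p := by linarith
          gcongr
      _ = _ := by ring

/-- The Poisson mean uses `n + 1` trials so that it exceeds `x` when `n = ⌊x/p⌋`. Descending from
`K`, the ratio comparison needs only `k + 1 ≤ p (n + 1)`. -/
theorem binomPMF_le_poisPMF_of_ge {n K : ℕ} {p : ℝ} (hp0 : 0 < p) (hp1 : p < 1)
    (h : (K + 1 : ℕ) + √((K + 1 : ℕ) : ℝ) ≤ p * (n + 1 : ℕ)) {k : ℕ} (hkK : k ≤ K) :
    binomPMF n p k ≤ poisPMF (p * (n + 1 : ℕ)) k := by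
  have hn' : (0 : ℝ) < (n + 1 : ℕ) := by positivity
  have hsq := Real.sqrt_nonneg ((K + 1 : ℕ) : ℝ)
  have hlt : p * (n + 1 : ℕ) < (n + 1 : ℕ) := by nlinarith
  have hKn : K + 1 < n + 1 := by
    have : ((K + 1 : ℕ) : ℝ) < (n + 1 : ℕ) := by linarith
    exact_mod_cast this
  induction hkK using Nat.decreasingInduction with
  | self =>
    have key := descFactorial_mul_one_sub_pow_mul_exp_le hKn.le (y := p * (n + 1 : ℕ))
      (by positivity) hlt (Or.inr h)
    -- The inequality for `n + 1` and `K + 1` loses a common factor `n + 1` and becomes the one for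
    -- `n` and `K`.
    rw [mul_div_assoc, div_self hn'.ne', mul_one, Nat.succ_descFactorial_succ, Nat.cast_mul,
      Nat.add_sub_add_right, pow_succ] at key
    apply binomPMF_le_poisPMF_of_descFactorial_le
    refine le_of_mul_le_mul_right ?_ hn'
    calc _ = p ^ K * ((n + 1 : ℕ) * n.descFactorial K * (1 - p) ^ (n - K)
          * Real.exp (p * (n + 1 : ℕ))) := by ring
      _ ≤ p ^ K * (((n + 1 : ℕ) : ℝ) ^ K * (n + 1 : ℕ)) := by gcongr
      _ = _ := by ring
  | of_succ k hk ih =>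
    have hb := binomPMF_succ_mul p (show k < n by omega)
    have hpo := poisPMF_succ_mul (p * (n + 1 : ℕ)) k
    have hb0 := binomPMF_nonneg hp0.le hp1.le n k
    have hk' : (k : ℝ) + 1 ≤ (K + 1 : ℕ) := by exact_mod_cast (by omega : k + 1 ≤ K + 1)
    have hq : 0 < p * (n + 1 : ℕ) * (1 - p) := mul_pos (by positivity) (by linarith)
    refine le_of_mul_le_mul_right ?_ hq
    calc binomPMF n p k * (p * (n + 1 : ℕ) * (1 - p)) ≤ binomPMF n p k * ((n - k) * p) := by
          refine mul_le_mul_of_nonneg_left ?_ hb0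
          push_cast at *
          nlinarith
      _ = binomPMF n p (k + 1) * ((k + 1) * (1 - p)) := hb.symm
      _ ≤ poisPMF (p * (n + 1 : ℕ)) (k + 1) * ((k + 1) * (1 - p)) := by
          have : 0 ≤ 1 - p := by linarith
          gcongr
      _ = _ := by rw [← mul_assoc, hpo]; ring

/-- If the mean `p m` is at most `N - √N`, then the tail above `N` of the binomial law is at most
that of the Poisson law of the same mean. -/
theorem sum_poisPMF_le_sum_binomPMF {m N : ℕ} {p : ℝ} (hp0 : 0 < p) (hp1 : p < 1)
    (h : p * m ≤ N - √(N : ℝ)) :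
    ∑ k ∈ Finset.range N, poisPMF (p * m) k ≤ ∑ k ∈ Finset.range N, binomPMF m p k := by
  -- With fewer than `N` trials the binomial sum is the full mass 1.
  rcases lt_or_ge m N with hm | hm
  · have hle : ∑ k ∈ Finset.range (m + 1), binomPMF m p k ≤ ∑ k ∈ Finset.range N, binomPMF m p k :=
      Finset.sum_le_sum_of_subset_of_nonneg (Finset.range_mono hm)
        fun k _ _ => binomPMF_nonneg hp0.le hp1.le m k
    rw [sum_binomPMF] at hle
    exact (sum_poisPMF_le_one (by positivity) N).trans hle
  rcases Nat.eq_zero_or_pos m with rfl | hm0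
  · obtain rfl : N = 0 := by omega
    simp
  have h1 := sum_binomPMF m p
  have h2 := sum_poisPMF_le_one (x := p * m) (by positivity) (m + 1)
  rw [← Finset.sum_range_add_sum_Ico _ (show N ≤ m + 1 by omega)] at h1 h2
  have h3 : ∑ k ∈ Finset.Ico N (m + 1), binomPMF m p k
      ≤ ∑ k ∈ Finset.Ico N (m + 1), poisPMF (p * m) k := by
    refine Finset.sum_le_sum fun k hk => ?_
    rw [Finset.mem_Ico] at hk
    exact binomPMF_le_poisPMF_of_le hp0 hp1 hm hm0 h hk.1 (by omega)
  linarith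

/-! ### The incomplete gamma function as a Poisson tail -/

theorem hasDerivAt_sum_poisPMF (n : ℕ) (x : ℝ) :
    HasDerivAt (fun x => ∑ k ∈ Finset.range (n + 1), poisPMF x k) (-poisPMF x n) x := by
  have he : HasDerivAt (fun x : ℝ => Real.exp (-x)) (-Real.exp (-x)) x := by
    simpa using (hasDerivAt_neg x).exp
  induction n with
  | zero => simpa [poisPMF] using he
  | succ n ih =>
    simp_rw [Finset.sum_range_succ _ (n + 1)]
    have h2 : HasDerivAt (fun x => poisPMF x (n + 1)) (-poisPMF x (n + 1) + poisPMF x n) x := by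
      have := (he.mul (hasDerivAt_pow (n + 1) x)).div_const ((n + 1).factorial : ℝ)
      refine this.congr_deriv ?_
      unfold poisPMF
      rw [Nat.factorial_succ]
      push_cast
      field_simp
    exact (ih.add h2).congr_deriv (by ring)

theorem regLowerGamma_eq (n : ℕ) {x : ℝ} :
    regLowerGamma ((n + 1 : ℕ) : ℝ) x = 1 - ∑ k ∈ Finset.range (n + 1), poisPMF x k := by
  have h1 : ∀ t : ℝ, HasDerivAt (fun x => -∑ k ∈ Finset.range (n + 1), poisPMF x k)
      (poisPMF t n) t := fun t => (hasDerivAt_sum_poisPMF n t).neg.congr_deriv (neg_neg _)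
  have h2 : Continuous (fun t => poisPMF t n) := by
    unfold poisPMF
    fun_prop
  have h3 := intervalIntegral.integral_eq_sub_of_hasDerivAt (a := 0) (b := x)
    (fun t _ => h1 t) (h2.intervalIntegrable _ _)
  have h0 : ∑ k ∈ Finset.range (n + 1), poisPMF 0 k = 1 := by
    rw [Finset.sum_range_succ']
    simp [poisPMF]
  unfold regLowerGamma
  rw [← intervalIntegral.integral_const_mul]
  have : ∀ t : ℝ, 1 / Real.Gamma ((n + 1 : ℕ) : ℝ) *
      (Real.exp (-t) * t ^ (((n + 1 : ℕ) : ℝ) - 1)) = poisPMF t n := by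
    intro t
    push_cast
    rw [Real.Gamma_nat_eq_factorial, add_sub_cancel_right, Real.rpow_natCast]
    unfold poisPMF
    ring
  simp_rw [this]
  rw [h3, h0]
  ring

theorem regLowerGamma_strictMonoOn (n : ℕ) :
    StrictMonoOn (regLowerGamma ((n + 1 : ℕ) : ℝ)) (Set.Ici 0) := by
  have h1 : ∀ t : ℝ, HasDerivAt (regLowerGamma ((n + 1 : ℕ) : ℝ)) (poisPMF t n) t := by
    intro t
    have := (hasDerivAt_sum_poisPMF n t).const_sub 1
    rw [neg_neg] at this
    exact this.congr_of_eventuallyEq (Filter.Eventually.of_forall fun x => regLowerGamma_eq n)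
  apply strictMonoOn_of_deriv_pos (convex_Ici 0)
  · exact fun t _ => (h1 t).continuousAt.continuousWithinAt
  · intro t ht
    rw [interior_Ici] at ht
    rw [(h1 t).deriv]
    have : 0 < t := ht
    unfold poisPMF
    positivity

/-! ### The number of trials in terms of occurrence counts -/

theorem occurrences_zero {Ω : Type*} (H : ℕ → Set Ω) (ω : Ω) : occurrences H 0 ω = 0 := by
  simp [occurrences]

theorem occurrences_succ_le {Ω : Type*} (H : ℕ → Set Ω) (k : ℕ) (ω : Ω) :
    occurrences H (k + 1) ω ≤ occurrences H k ω + 1 := by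
  classical
  unfold occurrences
  rw [Finset.range_add_one, Finset.filter_insert]
  split_ifs
  · exact Finset.card_insert_le _ _
  · omega

theorem occurrences_mono {Ω : Type*} (H : ℕ → Set Ω) (ω : Ω) :
    Monotone fun k => occurrences H k ω := by
  classical
  intro _ _ hab
  exact Finset.card_le_card (Finset.filter_subset_filter _ (Finset.range_mono hab))

theorem exists_occurrences_eq {Ω : Type*} (H : ℕ → Set Ω) (ω : Ω) {N k : ℕ}
    (h : N ≤ occurrences H k ω) : ∃ j ≤ k, occurrences H j ω = N := by
  induction k with
  | zero =>
    rw [occurrences_zero] at h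
    exact ⟨0, le_rfl, by rw [occurrences_zero]; omega⟩
  | succ k ih =>
    by_cases h' : N ≤ occurrences H k ω
    · obtain ⟨j, hj, e⟩ := ih h'
      exact ⟨j, by omega, e⟩
    · exact ⟨k + 1, le_rfl, by have := occurrences_succ_le H k ω; omega⟩

/-- Positivity excludes the default value `0`, taken when `N` occurrences are never reached. -/
theorem numTrials_pos_and_le_iff {Ω : Type*} (H : ℕ → Set Ω) (ω : Ω) {N : ℕ} (hN : 0 < N)
    (k : ℕ) : (0 < numTrials H N ω ∧ numTrials H N ω ≤ k) ↔ N ≤ occurrences H k ω := by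
  constructor
  · rintro ⟨h0, hk⟩
    have : numTrials H N ω ∈ {k : ℕ | occurrences H k ω = N} :=
      Nat.sInf_mem (Nat.nonempty_of_pos_sInf h0)
    rw [Set.mem_ofPred_eq] at this
    rw [← this]
    exact occurrences_mono H ω hk
  · intro h
    obtain ⟨j, hj, e⟩ := exists_occurrences_eq H ω h
    have hmem : numTrials H N ω ∈ {k : ℕ | occurrences H k ω = N} := Nat.sInf_mem ⟨j, e⟩
    refine ⟨?_, (Nat.sInf_le (show j ∈ {k : ℕ | occurrences H k ω = N} from e)).trans hj⟩
    rw [Nat.pos_iff_ne_zero]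
    intro h0
    rw [h0, Set.mem_ofPred_eq, occurrences_zero] at hmem
    omega

theorem estimator_mem_iff {Ω : Type*} (H : ℕ → Set Ω) (ω : Ω) {N : ℕ} (hN : 2 ≤ N)
    {p μ₁ μ₂ : ℝ} (hp : 0 < p) (hμ₁ : 0 < μ₁) (hμ₂ : 0 < μ₂) :
    (p / μ₂ ≤ estimator H N ω ∧ estimator H N ω ≤ p * μ₁) ↔
      N ≤ occurrences H ⌊((N : ℝ) - 1) * μ₂ / p⌋₊ ω ∧
      ¬ N ≤ occurrences H (⌈((N : ℝ) - 1) / μ₁ / p⌉₊ - 1) ω := by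
  have hN1 : (0 : ℝ) < (N : ℝ) - 1 := by
    have : (2 : ℝ) ≤ N := by exact_mod_cast hN
    linarith
  rw [← numTrials_pos_and_le_iff H ω (by omega), ← numTrials_pos_and_le_iff H ω (by omega)]
  unfold estimator
  have hy : 0 < ((N : ℝ) - 1) / μ₁ / p := by positivity
  have hc : 0 < ⌈((N : ℝ) - 1) / μ₁ / p⌉₊ := Nat.ceil_pos.mpr hy
  -- At the default value the estimator is `0 < p / μ₂`, so both sides are false.
  rcases Nat.eq_zero_or_pos (numTrials H N ω) with h0 | h0
  · rw [h0]
    simp only [lt_irrefl, false_and, iff_false, not_and, Nat.cast_zero, div_zero]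
    intro h
    have : 0 < p / μ₂ := by positivity
    linarith
  · have h0' : (0 : ℝ) < numTrials H N ω := by exact_mod_cast h0
    simp only [h0, true_and]
    apply and_congr
    · rw [Nat.le_floor_iff (by positivity), div_le_div_iff₀ hμ₂ h0', le_div_iff₀ hp,
        mul_comm p]
    · rw [not_le, show ∀ a b : ℕ, 0 < b → (b - 1 < a ↔ b ≤ a) from fun a b _ => by omega]
      · rw [Nat.ceil_le, div_div, div_le_iff₀ h0', div_le_iff₀ (by positivity),
          mul_comm (_ : ℝ) (μ₁ * p), mul_comm p]
      · exact hc

/-! ### The binomial law and the exact confidence -/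

theorem measurableSet_biInter_ite {Ω : Type*} [MeasurableSpace Ω] {H : ℕ → Set Ω}
    (hH : ∀ i, MeasurableSet (H i)) (k : ℕ) (S : Finset ℕ) :
    MeasurableSet (⋂ i ∈ Finset.range k, if i ∈ S then H i else (H i)ᶜ) := by
  refine Finset.measurableSet_biInter _ fun i _ => ?_
  split_ifs
  · exact hH i
  · exact (hH i).compl

/-- Splitting by the set of successful trials gives disjoint pieces whose probabilities follow from
independence. -/
theorem setOf_occurrences_eq {Ω : Type*} (H : ℕ → Set Ω) (k j : ℕ) :
    {ω | occurrences H k ω = j} = ⋃ S ∈ Finset.powersetCard j (Finset.range k),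
      ⋂ i ∈ Finset.range k, if i ∈ S then H i else (H i)ᶜ := by
  classical
  ext ω
  simp only [Set.mem_ofPred_eq, Set.mem_iUnion, Set.mem_iInter, exists_prop]
  constructor
  · intro h
    refine ⟨(Finset.range k).filter (fun i => ω ∈ H i), ?_, ?_⟩
    · rw [Finset.mem_powersetCard]
      refine ⟨Finset.filter_subset _ _, ?_⟩
      rw [← h]
      unfold occurrences
      congr
    · intro i hi
      by_cases hω : ω ∈ H i
      · simp [hω, Finset.mem_range.mp hi]
      · simp [hω]
  · rintro ⟨S, hS, h⟩
    rw [Finset.mem_powersetCard] at hS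
    rw [← hS.2]
    unfold occurrences
    congr 1
    ext i
    rw [Finset.mem_filter]
    constructor
    · rintro ⟨hi, hω⟩
      by_contra hiS
      have := h i hi
      rw [if_neg hiS] at this
      exact this hω
    · intro hiS
      have := h i (hS.1 hiS)
      rw [if_pos hiS] at this
      exact ⟨hS.1 hiS, this⟩

theorem measurableSet_occurrences_eq {Ω : Type*} [MeasurableSpace Ω] {H : ℕ → Set Ω}
    (hH : ∀ i, MeasurableSet (H i)) (k j : ℕ) : MeasurableSet {ω | occurrences H k ω = j} := by
  rw [setOf_occurrences_eq]
  exact Finset.measurableSet_biUnion _ fun S _ => measurableSet_biInter_ite hH k S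

theorem measurable_occurrences {Ω : Type*} [MeasurableSpace Ω] {H : ℕ → Set Ω}
    (hH : ∀ i, MeasurableSet (H i)) (k : ℕ) : Measurable (occurrences H k) :=
  measurable_to_countable' fun j => measurableSet_occurrences_eq hH k j

theorem IsIndepTrials.measureReal_biInter_ite {Ω : Type*} [MeasurableSpace Ω] {P : Measure Ω}
    {H : ℕ → Set Ω} {p : ℝ} (h : IsIndepTrials P H p) (hp : 0 ≤ p) {k : ℕ} {S : Finset ℕ}
    (hS : S ⊆ Finset.range k) :
    P.real (⋂ i ∈ Finset.range k, if i ∈ S then H i else (H i)ᶜ)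
      = p ^ S.card * (1 - p) ^ (k - S.card) := by
  have := h.isProbabilityMeasure
  have hind := (iIndepSet_iff_iIndep H P).mp h.indep
  have hmem : ∀ i, MeasurableSet[MeasurableSpace.generateFrom {H i}] (H i) := fun i =>
    MeasurableSpace.measurableSet_generateFrom rfl
  have hprod := hind.meas_biInter (S := Finset.range k)
    (s := fun i => if i ∈ S then H i else (H i)ᶜ) fun i _ => by
      split_ifs
      · exact hmem i
      · exact (hmem i).compl
  have hr : ∀ i, P.real (H i) = p := fun i => by
    rw [measureReal_def, h.prob i, ENNReal.toReal_ofReal hp]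
  have hrc : ∀ i, P.real (H i)ᶜ = 1 - p := fun i => by
    rw [probReal_compl_eq_one_sub (h.measurableSet i), hr]
  rw [measureReal_def, hprod, ENNReal.toReal_prod]
  have : ∀ i, (P (if i ∈ S then H i else (H i)ᶜ)).toReal = if i ∈ S then p else 1 - p := by
    intro i
    split_ifs
    · exact hr i
    · exact hrc i
  simp_rw [this]
  rw [Finset.prod_ite, Finset.prod_const, Finset.prod_const, Finset.filter_mem_eq_inter,
    Finset.inter_eq_right.mpr hS, Finset.filter_notMem_eq_sdiff, Finset.card_sdiff_of_subset hS,
    Finset.card_range]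

theorem IsIndepTrials.measureReal_occurrences_eq {Ω : Type*} [MeasurableSpace Ω] {P : Measure Ω}
    {H : ℕ → Set Ω} {p : ℝ} (h : IsIndepTrials P H p) (hp : 0 ≤ p) (k j : ℕ) :
    P.real {ω | occurrences H k ω = j} = binomPMF k p j := by
  have := h.isProbabilityMeasure
  rw [setOf_occurrences_eq, measureReal_biUnion_finset]
  · have hS : ∀ S ∈ Finset.powersetCard j (Finset.range k),
        P.real (⋂ i ∈ Finset.range k, if i ∈ S then H i else (H i)ᶜ)
          = p ^ j * (1 - p) ^ (k - j) := by
      intro S hS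
      rw [Finset.mem_powersetCard] at hS
      rw [h.measureReal_biInter_ite hp hS.1, hS.2]
    rw [Finset.sum_congr rfl hS, Finset.sum_const, Finset.card_powersetCard, Finset.card_range, nsmul_eq_mul]
    unfold binomPMF
    ring
  · intro S hS T hT hST
    rw [Finset.mem_coe, Finset.mem_powersetCard] at hS hT
    rw [Function.onFun, Set.disjoint_left]
    intro ω hω hω'
    apply hST
    simp only [Set.mem_iInter] at hω hω'
    ext i
    by_cases hi : i ∈ Finset.range k
    · have h1 := hω i hi
      have h2 := hω' i hi
      by_cases hiS : i ∈ S <;> by_cases hiT : i ∈ T <;> simp_all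
    · exact ⟨fun hh => absurd (hS.1 hh) hi, fun hh => absurd (hT.1 hh) hi⟩
  · exact fun S _ => measurableSet_biInter_ite h.measurableSet k S

theorem IsIndepTrials.measureReal_le_occurrences {Ω : Type*} [MeasurableSpace Ω] {P : Measure Ω}
    {H : ℕ → Set Ω} {p : ℝ} (h : IsIndepTrials P H p) (hp : 0 ≤ p) (N k : ℕ) :
    P.real {ω | N ≤ occurrences H k ω} = 1 - ∑ j ∈ Finset.range N, binomPMF k p j := by
  have := h.isProbabilityMeasure
  have hc : {ω | N ≤ occurrences H k ω}
      = (⋃ j ∈ Finset.range N, {ω | occurrences H k ω = j})ᶜ := by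
    ext ω
    simp only [Finset.mem_range, Set.mem_ofPred_eq, Set.mem_compl_iff, Set.mem_iUnion,
      exists_prop, exists_eq_right', not_lt]
  have hm : ∀ j ∈ Finset.range N, MeasurableSet {ω | occurrences H k ω = j} := fun j _ =>
    measurableSet_occurrences_eq h.measurableSet k j
  rw [hc, probReal_compl_eq_one_sub (Finset.measurableSet_biUnion _ hm),
    measureReal_biUnion_finset _ hm]
  · simp_rw [h.measureReal_occurrences_eq hp]
  · intro i _ j _ hij
    rw [Function.onFun, Set.disjoint_left]
    rintro ω rfl h'
    exact hij h'

theorem IsIndepTrials.confidence_eq {Ω : Type*} [MeasurableSpace Ω] {P : Measure Ω}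
    {H : ℕ → Set Ω} {p : ℝ} (h : IsIndepTrials P H p) (hp : 0 < p) {N : ℕ} (hN : 2 ≤ N)
    {μ₁ μ₂ : ℝ} (hμ₁ : 1 < μ₁) (hμ₂ : 1 < μ₂) :
    confidence P H N p μ₁ μ₂ =
      ∑ j ∈ Finset.range N, binomPMF (⌈((N : ℝ) - 1) / μ₁ / p⌉₊ - 1) p j -
      ∑ j ∈ Finset.range N, binomPMF ⌊((N : ℝ) - 1) * μ₂ / p⌋₊ p j := by
  have := h.isProbabilityMeasure
  have hN1 : (0 : ℝ) < (N : ℝ) - 1 := by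
    have : (2 : ℝ) ≤ N := by exact_mod_cast hN
    linarith
  have hle : ⌈((N : ℝ) - 1) / μ₁ / p⌉₊ - 1 ≤ ⌊((N : ℝ) - 1) * μ₂ / p⌋₊ := by
    rw [Nat.le_floor_iff (by positivity)]
    have h1 : ((⌈((N : ℝ) - 1) / μ₁ / p⌉₊ - 1 : ℕ) : ℝ) ≤ ((N : ℝ) - 1) / μ₁ / p := by
      have := Nat.ceil_lt_add_one (show 0 ≤ ((N : ℝ) - 1) / μ₁ / p by positivity)
      have hc : 0 < ⌈((N : ℝ) - 1) / μ₁ / p⌉₊ := Nat.ceil_pos.mpr (by positivity)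
      rw [Nat.cast_sub hc]
      push_cast
      linarith
    refine h1.trans ?_
    gcongr
    exact (div_le_self hN1.le hμ₁.le).trans (le_mul_of_one_le_right hN1.le hμ₂.le)
  unfold confidence
  simp_rw [estimator_mem_iff H _ hN hp (zero_lt_one.trans hμ₁) (zero_lt_one.trans hμ₂)]
  change P.real ({ω | N ≤ occurrences H ⌊((N : ℝ) - 1) * μ₂ / p⌋₊ ω} \
    {ω | N ≤ occurrences H (⌈((N : ℝ) - 1) / μ₁ / p⌉₊ - 1) ω}) = _
  rw [measureReal_sdiff, h.measureReal_le_occurrences hp.le, h.measureReal_le_occurrences hp.le]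
  · ring
  · exact fun ω (hω : N ≤ _) => hω.trans (occurrences_mono H ω hle)
  · exact measurableSet_le measurable_const (measurable_occurrences h.measurableSet _)

/-! ### The Poisson limit -/

open Filter Topology in
theorem tendsto_cast_sub_mul {n : ℝ → ℕ} {x : ℝ}
    (hn : Tendsto (fun p => (n p : ℝ) * p) (𝓝[>] 0) (𝓝 x)) (i : ℕ) :
    Tendsto (fun p => ((n p - i : ℕ) : ℝ) * p) (𝓝[>] 0) (𝓝 x) := by
  have hp : Tendsto (fun p : ℝ => p) (𝓝[>] 0) (𝓝 0) := tendsto_nhdsWithin_of_tendsto_nhds tendsto_id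
  have hlow : Tendsto (fun p => (n p : ℝ) * p - i * p) (𝓝[>] 0) (𝓝 x) := by
    simpa using hn.sub (hp.const_mul (i : ℝ))
  refine tendsto_of_tendsto_of_tendsto_of_le_of_le' hlow hn ?_ ?_
  · filter_upwards [self_mem_nhdsWithin] with p hp
    have hp : 0 < p := hp
    rw [← sub_mul]
    gcongr
    have : n p ≤ (n p - i) + i := by omega
    have : (n p : ℝ) ≤ ((n p - i : ℕ) : ℝ) + i := by exact_mod_cast this
    linarith
  · filter_upwards [self_mem_nhdsWithin] with p hp
    have hp : 0 < p := hp
    gcongr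
    omega

open Filter Topology in
theorem tendsto_one_sub_pow {n : ℝ → ℕ} {x : ℝ}
    (hn : Tendsto (fun p => (n p : ℝ) * p) (𝓝[>] 0) (𝓝 x)) :
    Tendsto (fun p => (1 - p) ^ n p) (𝓝[>] 0) (𝓝 (Real.exp (-x))) := by
  have hd : HasDerivAt (fun p : ℝ => Real.log (1 - p)) (-1) 0 := by
    have := ((hasDerivAt_id (0 : ℝ)).const_sub 1).log (by simp)
    simpa using this
  have hs : Tendsto (fun p : ℝ => p⁻¹ * Real.log (1 - p)) (𝓝[>] 0) (𝓝 (-1)) := by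
    have := hd.hasDerivWithinAt (s := Set.Ioi 0)
    rw [hasDerivWithinAt_iff_tendsto_slope' (by simp)] at this
    refine this.congr fun p => ?_
    simp [slope_def_field, div_eq_inv_mul]
  have h := (Real.continuous_exp.tendsto _).comp (hn.mul hs)
  rw [mul_neg_one] at h
  refine h.congr' ?_
  filter_upwards [Ioo_mem_nhdsGT (zero_lt_one' ℝ)] with p hp
  have hp0 : p ≠ 0 := hp.1.ne'
  have h1 : 0 < 1 - p := by linarith [hp.2]
  rw [Function.comp_apply, mul_assoc, mul_inv_cancel_left₀ hp0, Real.exp_nat_mul, Real.exp_log h1]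

open Filter Topology in
/-- The Poisson limit of binomial laws, along any family of sizes `n p` with `n p * p → x`. -/
theorem tendsto_binomPMF {n : ℝ → ℕ} {x : ℝ}
    (hn : Tendsto (fun p => (n p : ℝ) * p) (𝓝[>] 0) (𝓝 x)) (k : ℕ) :
    Tendsto (fun p => binomPMF (n p) p k) (𝓝[>] 0) (𝓝 (poisPMF x k)) := by
  -- The falling factorial times `p ^ k` is a product of `k` factors, each tending to `x`.
  have h1 : Tendsto (fun p => ∏ i ∈ Finset.range k, ((n p - i : ℕ) : ℝ) * p) (𝓝[>] 0)
      (𝓝 (∏ _i ∈ Finset.range k, x)) :=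
    tendsto_finsetProd _ fun i _ => tendsto_cast_sub_mul hn i
  have h2 := tendsto_one_sub_pow (tendsto_cast_sub_mul hn k)
  have h3 := (h1.mul h2).div_const (k.factorial : ℝ)
  rw [Finset.prod_const, Finset.card_range] at h3
  have e : poisPMF x k = x ^ k * Real.exp (-x) / k.factorial := by
    unfold poisPMF
    ring
  rw [e]
  refine h3.congr fun p => ?_
  rw [Finset.prod_mul_distrib, Finset.prod_const, Finset.card_range, ← Nat.cast_prod,
    ← Nat.descFactorial_eq_prod_range, Nat.descFactorial_eq_factorial_mul_choose]
  unfold binomPMF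
  push_cast
  field_simp

open Filter Topology in
theorem tendsto_natCast_mul_of_mem_Icc {n : ℝ → ℕ} {x : ℝ}
    (h : ∀ p > 0, x / p - 1 ≤ n p ∧ n p ≤ x / p) :
    Tendsto (fun p => (n p : ℝ) * p) (𝓝[>] 0) (𝓝 x) := by
  have hp : Tendsto (fun p : ℝ => x - p) (𝓝[>] 0) (𝓝 x) := by
    have : Tendsto (fun p : ℝ => x - p) (𝓝 0) (𝓝 (x - 0)) := tendsto_const_nhds.sub tendsto_id
    rw [sub_zero] at this
    exact tendsto_nhdsWithin_of_tendsto_nhds this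
  refine tendsto_of_tendsto_of_tendsto_of_le_of_le' hp tendsto_const_nhds ?_ ?_
  · filter_upwards [self_mem_nhdsWithin] with p hp
    have hp : 0 < p := hp
    have := mul_le_mul_of_nonneg_right (h p hp).1 hp.le
    rwa [sub_mul, div_mul_cancel₀ _ hp.ne', one_mul] at this
  · filter_upwards [self_mem_nhdsWithin] with p hp
    have hp : 0 < p := hp
    exact (le_div_iff₀ hp).mp (h p hp).2

/-! ### Rounding and the main theorem -/

theorem cast_ceil_sub_one_lt {a : ℝ} (ha : 0 < a) : ((⌈a⌉₊ - 1 : ℕ) : ℝ) < a := by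
  rw [Nat.cast_sub (Nat.ceil_pos.mpr ha)]
  have := Nat.ceil_lt_add_one ha.le
  push_cast
  linarith

theorem sub_one_le_cast_ceil_sub_one {a : ℝ} (ha : 0 < a) : a - 1 ≤ ((⌈a⌉₊ - 1 : ℕ) : ℝ) := by
  rw [Nat.cast_sub (Nat.ceil_pos.mpr ha)]
  have := Nat.le_ceil a
  push_cast
  linarith

/-- Turns the condition on `μ₁` into the weaker `y ≤ N - √N` that the comparison needs. -/
theorem sqrt_le_one_half_add_sqrt_sub {a : ℝ} (ha : 1 ≤ a) : √a ≤ 1 / 2 + √(a - 1 / 2) := by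
  have h : 1 / 4 ≤ √(a - 1 / 2) := Real.le_sqrt_of_sq_le (by linarith)
  have h2 := Real.sq_sqrt (show 0 ≤ a - 1 / 2 by linarith)
  rw [Real.sqrt_le_left (by positivity)]
  nlinarith

theorem proposition1 (N : ℕ) (hN : 3 ≤ N) (μ₁ μ₂ : ℝ) (hμ₁ : 1 < μ₁) (hμ₂ : 1 < μ₂) :
    -- the confidence tends to `c̄` as `p → 0`
    (∀ (Ω : ℝ → Type*) [∀ p, MeasurableSpace (Ω p)] (P : ∀ p, Measure (Ω p))
        (H : ∀ p, ℕ → Set (Ω p)),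
        (∀ p ∈ Set.Ioo (0 : ℝ) 1, IsIndepTrials (P p) (H p) p) →
        Filter.Tendsto (fun p => confidence (P p) (H p) N p μ₁ μ₂)
          (nhdsWithin 0 (Set.Ioi 0)) (nhds (asympConfidence N μ₁ μ₂))) ∧
    -- the confidence exceeds `c̄` for every `p`
    (μ₂ ≥ ((N : ℝ) + √(N : ℝ)) / ((N : ℝ) - 1) →
      μ₁ ≥ ((N : ℝ) - 1) / ((N : ℝ) - 1 / 2 - √((N : ℝ) - 1 / 2)) →
      ∀ p ∈ Set.Ioo (0 : ℝ) 1,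
        ∀ (Ω : Type*) [MeasurableSpace Ω] (P : Measure Ω) (H : ℕ → Set Ω),
          IsIndepTrials P H p →
          confidence P H N p μ₁ μ₂ > asympConfidence N μ₁ μ₂) := by
  have hN3 : (3 : ℝ) ≤ N := by exact_mod_cast hN
  have hN1 : (0 : ℝ) < (N : ℝ) - 1 := by linarith
  obtain ⟨K, rfl⟩ : ∃ K, N = K + 1 := ⟨N - 1, by omega⟩
  set x := (((K + 1 : ℕ) : ℝ) - 1) * μ₂ with hx
  set y := (((K + 1 : ℕ) : ℝ) - 1) / μ₁ with hy
  have hx0 : 0 < x := by positivity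
  have hy0 : 0 < y := by positivity
  have hc : asympConfidence (K + 1) μ₁ μ₂ = ∑ j ∈ Finset.range (K + 1), poisPMF y j
      - ∑ j ∈ Finset.range (K + 1), poisPMF x j := by
    unfold asympConfidence
    rw [regLowerGamma_eq, regLowerGamma_eq]
    ring
  constructor
  · intro Ω _ P H h
    rw [hc]
    have t1 : Filter.Tendsto (fun p => ∑ j ∈ Finset.range (K + 1), binomPMF (⌈y / p⌉₊ - 1) p j)
        (nhdsWithin 0 (Set.Ioi 0)) (nhds (∑ j ∈ Finset.range (K + 1), poisPMF y j)) := by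
      refine tendsto_finsetSum _ fun j _ => tendsto_binomPMF ?_ j
      refine tendsto_natCast_mul_of_mem_Icc fun p hp => ?_
      exact ⟨sub_one_le_cast_ceil_sub_one (by positivity), (cast_ceil_sub_one_lt (by positivity)).le⟩
    have t2 : Filter.Tendsto (fun p => ∑ j ∈ Finset.range (K + 1), binomPMF ⌊x / p⌋₊ p j)
        (nhdsWithin 0 (Set.Ioi 0)) (nhds (∑ j ∈ Finset.range (K + 1), poisPMF x j)) := by
      refine tendsto_finsetSum _ fun j _ => tendsto_binomPMF ?_ j
      refine tendsto_natCast_mul_of_mem_Icc fun p hp => ?_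
      exact ⟨(Nat.sub_one_lt_floor _).le, Nat.floor_le (by positivity)⟩
    refine (t1.sub t2).congr' ?_
    filter_upwards [Ioo_mem_nhdsGT (zero_lt_one' ℝ)] with p hp
    exact ((h p hp).confidence_eq hp.1 (by omega) hμ₁ hμ₂).symm
  · intro h2 h1 p hp Ω _ P H h
    have hxN : ((K + 1 : ℕ) : ℝ) + √((K + 1 : ℕ) : ℝ) ≤ x := by
      rw [ge_iff_le, div_le_iff₀ hN1] at h2
      linarith
    have hyN : y ≤ ((K + 1 : ℕ) : ℝ) - √((K + 1 : ℕ) : ℝ) := by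
      have hden : 0 < ((K + 1 : ℕ) : ℝ) - 1 / 2 - √(((K + 1 : ℕ) : ℝ) - 1 / 2) := by
        rw [sub_pos, Real.sqrt_lt' (by linarith)]
        nlinarith
      have hle : y ≤ ((K + 1 : ℕ) : ℝ) - 1 / 2 - √(((K + 1 : ℕ) : ℝ) - 1 / 2) := by
        rw [ge_iff_le, div_le_iff₀ hden] at h1
        rw [hy, div_le_iff₀ (by linarith)]
        linarith
      have := sqrt_le_one_half_add_sqrt_sub (show 1 ≤ ((K + 1 : ℕ) : ℝ) by linarith)
      linarith
    rw [h.confidence_eq hp.1 (by omega) hμ₁ hμ₂, hc, ← hx, ← hy]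
    have hyp : p * (⌈y / p⌉₊ - 1 : ℕ) < y := by
      have := cast_ceil_sub_one_lt (div_pos hy0 hp.1)
      rwa [lt_div_iff₀ hp.1, mul_comm] at this
    have hxp : x < p * (⌊x / p⌋₊ + 1 : ℕ) := by
      have := Nat.lt_floor_add_one (x / p)
      rw [div_lt_iff₀ hp.1, mul_comm] at this
      exact_mod_cast this
    have b1 := sum_poisPMF_le_sum_binomPMF hp.1 hp.2 (hyp.le.trans hyN)
    have b2 : ∑ j ∈ Finset.range (K + 1), binomPMF ⌊x / p⌋₊ p j
        ≤ ∑ j ∈ Finset.range (K + 1), poisPMF (p * (⌊x / p⌋₊ + 1 : ℕ)) j :=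
      Finset.sum_le_sum fun j hj => binomPMF_le_poisPMF_of_ge hp.1 hp.2 (hxN.trans hxp.le)
        (Nat.lt_succ_iff.mp (Finset.mem_range.mp hj))
    have hp0 := hp.1
    -- The strictness of the conclusion comes from here: both rounding inequalities are strict.
    have m1 := regLowerGamma_strictMonoOn K
      (show 0 ≤ p * ((⌈y / p⌉₊ - 1 : ℕ) : ℝ) by positivity) hy0.le hyp
    have m2 := regLowerGamma_strictMonoOn K hx0.le (hx0.trans hxp).le hxp
    rw [regLowerGamma_eq, regLowerGamma_eq] at m1 m2
    linarith
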